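/- **Definitions.** Let $d\ge 1$. For a real $a\ge 1$, a family $F$ of subsets ("objects") of $\mathbb{R}^d$ is *$a$-stabbed* if for every real $r$ and every ball $B$ of radius $r$ there is a set $P$ of at most $a^d$ points such that every object $o\in F$ with $o\subseteq B$ and $r/2\le \operatorname{diam}(o)<r$ contains a point of $P$. The *stabbing number* of $F$ is the infimum of all $a\in[1,\infty)$ for which $F$ is $a$-stabbed. For $0<\beta\le 1$, a measurable object $o\subseteq\mathbb{R}^d$ is *weakly $\beta$-fat* if $\operatorname{Vol}(o)\ge \beta^d\operatorname{Vol}(B)$, where $B$ is the circumscribed ball of $o$ (the ball of least radius containing $o$; in particular $o$ is bounded). **Theorem.** Let $d\ge 1$ be fixed. The stabbing number of any family of $n$ weakly $(1/\alpha)$-fat convex objects in $\mathbb{R}^d$ is $O(\alpha\log^{1/d}\alpha)$, where the implied constant depends only on $d$ (in particular the bound is independent of $n$). Precisely: there is a constant $C=C(d)>0$ such that for every $n$, every real $\alpha\ge 1$ and every family $F$ of $n$ convex subsets of $\mathbb{R}^d$, each of which is weakly $(1/\alpha)$-fat, the stabbing number of $F$ is at most $C\,\alpha\,(1+\log\alpha)^{1/d}$,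 and it is at most $C\,\alpha\,\log^{1/d}\alpha$ if $\alpha\ge 2$. -/

import Mathlib

open MeasureTheory
open scoped ENNReal

/-- The points of `P` stab the family `G`: every object of `G` contains a point of `P`. -/
def Stabs {X : Type*} (P : Finset X) (G : Set (Set X)) : Prop :=
  ∀ o ∈ G, ∃ p ∈ P, p ∈ o

/-- The objects `o` of `F` with `diam o ∈ [r/2, r)` that are contained in the (closed) ball with
centre `x` and radius `r`. Such objects are bounded, so `Metric.diam` is the true diameter. -/
def scaleSubfamily {d : ℕ} (F : Set (Set (EuclideanSpace ℝ (Fin d))))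
    (x : EuclideanSpace ℝ (Fin d)) (r : ℝ) : Set (Set (EuclideanSpace ℝ (Fin d))) :=
  {o | o ∈ F ∧ o ⊆ Metric.closedBall x r ∧ Metric.diam o ∈ Set.Ico (r / 2) r}

/-- `F` is `a`-stabbed: for every `r` and every ball of radius `r`, the objects of `F` of diameter
in `[r/2, r)` contained in that ball can be stabbed by (at most) `a ^ d` points. -/
def IsStabbed {d : ℕ} (a : ℝ) (F : Set (Set (EuclideanSpace ℝ (Fin d)))) : Prop :=
  ∀ (r : ℝ) (x : EuclideanSpace ℝ (Fin d)),
    ∃ P : Finset (EuclideanSpace ℝ (Fin d)), (P.card : ℝ) ≤ a ^ d ∧ Stabs P (scaleSubfamily F x r)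

/-- The stabbing number: the infimum of all `a ∈ [1, ∞)` for which `F` is `a`-stabbed (it is `∞`
if there is no such `a`). -/
noncomputable def stabbingNumber {d : ℕ} (F : Set (Set (EuclideanSpace ℝ (Fin d)))) : ℝ≥0∞ :=
  ⨅ (a : ℝ) (_ : 1 ≤ a) (_ : IsStabbed a F), ENNReal.ofReal a

/-- The closed ball with centre `c` and radius `R` is a circumscribed ball of `o`, that is, a ball
of least radius containing `o`. -/
def IsCircumscribedBall {d : ℕ} (c : EuclideanSpace ℝ (Fin d)) (R : ℝ)
    (o : Set (EuclideanSpace ℝ (Fin d))) : Prop :=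
  0 ≤ R ∧ o ⊆ Metric.closedBall c R ∧
    ∀ (c' : EuclideanSpace ℝ (Fin d)) (R' : ℝ), 0 ≤ R' → o ⊆ Metric.closedBall c' R' → R ≤ R'

/-- `o` is weakly `β`-fat: it is Lebesgue measurable and `Vol(o) ≥ β ^ d * Vol(B)`, where `B` is
its circumscribed ball. (In particular `o` is bounded.) -/
def IsWeaklyFat {d : ℕ} (β : ℝ) (o : Set (EuclideanSpace ℝ (Fin d))) : Prop :=
  NullMeasurableSet o volume ∧
    ∃ (c : EuclideanSpace ℝ (Fin d)) (R : ℝ), IsCircumscribedBall c R o ∧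
      ENNReal.ofReal (β ^ d) * volume (Metric.closedBall c R) ≤ volume o

/-!
The points that stab the objects in a fixed ball can be chosen before the objects are known: for
every ball `B` in `ℝ^d` there is a set of `O(α ^ d * (1 + log α))` points that meets *every* convex
set `o ⊆ B` with `vol o ≥ α ^ (-d) * vol B` (`exists_stabbing_finset_closedBall`). The theorem
follows, since a weakly `(1/α)`-fat object of diameter at least `r / 2` has a circumscribed ball of
radius at least `r / 4`, hence volume at least `(4 * α) ^ (-d)` times that of a ball of radius `r`
(`volume_le_of_isWeaklyFat`).

The universal stabbing set is found in the unit ball. All convex sets together have infinite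
VC dimension, so they are replaced by parallelepipeds.

* *Inner boxes.* Fix `x₀ ∈ o` and choose `v₁, …, v_d ∈ o` for which `|det (vᵢ - x₀)|` is within a
  factor `2` of its supremum. By Cramer's rule all of `o` lies in the parallelepiped
  `x₀ + ∑ tᵢ (vᵢ - x₀)`, `|tᵢ| ≤ 2`, while the simplex with vertices `x₀, v₁, …, v_d` contains a
  parallelepiped of comparable volume. So `o` contains a parallelepiped of volume at least
  `vol o / (4 * d) ^ d` (`exists_centeredBox_subset`).
* *Discretization.* A parallelepiped of volume bounded below still contains the half-size version
  of each parallelepiped with nearly the same centre and edges (`centeredBox_subset_centeredBox`).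
  Rounding the `d + d ^ 2` coordinates therefore gives a family of parallelepipeds, of cardinality
  polynomial in `α`, such that each `o` contains a member (`exists_finset_small_boxes`).
* *Greedy stabbing.* If each of `K` sets has probability at least `p`, some point lies in a
  fraction `p` of them. Taking such points repeatedly stabs all of the sets with
  `log K / p + 1` points (`exists_hitting_set`). Here `1 / p = (8 * d * α) ^ d` and
  `log K = O(1 + log α)`.
-/

/-! ### Greedy hitting sets -/

/-- First moment method: some point lies in at least a fraction `p` of the sets `S i`, `i ∈ T`, so
that at most a fraction `1 - p` of them (those in `T'`) is left. -/
theorem exists_mem_and_card_unhit_le {X ι : Type*} [MeasurableSpace X] (μ : Measure X)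
    [IsProbabilityMeasure μ] (S : ι → Set X) (hS : ∀ i, MeasurableSet (S i)) {p : ℝ}
    (hp : ∀ i, p ≤ μ.real (S i)) (T : Finset ι) :
    ∃ x, ∃ T' ⊆ T, (∀ i ∈ T, i ∉ T' → x ∈ S i) ∧ (T'.card : ℝ) ≤ (1 - p) * T.card := by
  classical
  have hint : ∀ i ∈ T, Integrable ((S i).indicator (fun _ ↦ (1 : ℝ))) μ := fun i _ ↦
    (integrable_const 1).indicator (hS i)
  obtain ⟨x, hx⟩ := exists_integral_le (integrable_finsetSum T hint)
  refine ⟨x, T.filter (fun i ↦ x ∉ S i), Finset.filter_subset _ _, fun i hi h ↦ ?_, ?_⟩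
  · by_contra hxi
    exact h (Finset.mem_filter.2 ⟨hi, hxi⟩)
  · rw [integral_finsetSum T hint] at hx
    have h1 : p * T.card ≤ ∑ i ∈ T, ∫ a, (S i).indicator (fun _ ↦ (1 : ℝ)) a ∂μ := by
      calc p * T.card = ∑ _i ∈ T, p := by simp [mul_comm]
        _ ≤ _ := Finset.sum_le_sum fun i _ ↦ by
          rw [integral_indicator_const _ (hS i)]; simpa using hp i
    have h2 : ∑ i ∈ T, (S i).indicator (fun _ ↦ (1 : ℝ)) x
        = ((T.filter (fun i ↦ x ∈ S i)).card : ℝ) := by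
      simp [Set.indicator_apply]
    have h3 : ((T.filter (fun i ↦ x ∈ S i)).card : ℝ) + (T.filter (fun i ↦ x ∉ S i)).card
        = T.card := by
      exact_mod_cast Finset.card_filter_add_card_filter_not (s := T) (fun i ↦ x ∈ S i)
    linarith

/-- After `m` greedy choices of points, the set `T'` of indices of sets not yet hit has at most
`(1 - p) ^ m * #T` elements. -/
theorem exists_finset_card_le_and_card_unhit_le {X ι : Type*} [MeasurableSpace X] (μ : Measure X)
    [IsProbabilityMeasure μ] (S : ι → Set X) (hS : ∀ i, MeasurableSet (S i)) {p : ℝ}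
    (hp1 : p ≤ 1) (hp : ∀ i, p ≤ μ.real (S i)) (T : Finset ι) (m : ℕ) :
    ∃ P : Finset X, P.card ≤ m ∧ ∃ T' ⊆ T, (∀ i ∈ T, i ∉ T' → ∃ x ∈ P, x ∈ S i) ∧
      (T'.card : ℝ) ≤ (1 - p) ^ m * T.card := by
  classical
  induction m with
  | zero => exact ⟨∅, by simp, T, subset_rfl, fun i hi h ↦ (h hi).elim, by simp⟩
  | succ m ih =>
    obtain ⟨P, hP, T', hT', hit, hcard⟩ := ih
    obtain ⟨x, T'', hT'', hit', hcard'⟩ := exists_mem_and_card_unhit_le μ S hS hp T'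
    refine ⟨insert x P, (Finset.card_insert_le _ _).trans (by lia), T'', hT''.trans hT', ?_, ?_⟩
    · intro i hi hi''
      by_cases h : i ∈ T'
      · exact ⟨x, Finset.mem_insert_self _ _, hit' i h hi''⟩
      · obtain ⟨y, hy, hyi⟩ := hit i hi h
        exact ⟨y, Finset.mem_insert_of_mem hy, hyi⟩
    · calc (T''.card : ℝ) ≤ (1 - p) * T'.card := hcard'
        _ ≤ (1 - p) * ((1 - p) ^ m * T.card) := by gcongr
        _ = _ := by ring

/-- Finitely many sets of probability at least `p` have a hitting set of size `log (#T) / p + 1`. -/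
theorem exists_hitting_set {X ι : Type*} [MeasurableSpace X] (μ : Measure X)
    [IsProbabilityMeasure μ] (S : ι → Set X) (hS : ∀ i, MeasurableSet (S i)) {p : ℝ} (hp0 : 0 < p)
    (hp : ∀ i, p ≤ μ.real (S i)) (T : Finset ι) :
    ∃ P : Finset X, (P.card : ℝ) ≤ Real.log T.card / p + 1 ∧ ∀ i ∈ T, ∃ x ∈ P, x ∈ S i := by
  rcases T.eq_empty_or_nonempty with rfl | hT
  · exact ⟨∅, by simp, by simp⟩
  have hp1 : p ≤ 1 := (hp hT.choose).trans measureReal_le_one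
  have hT1 : (1 : ℝ) ≤ T.card := by exact_mod_cast hT.card_pos
  have hlog : 0 ≤ Real.log T.card / p := div_nonneg (Real.log_nonneg hT1) hp0.le
  obtain ⟨P, hP, T', -, hit, hcard⟩ := exists_finset_card_le_and_card_unhit_le μ S hS hp1 hp T
    (⌊Real.log T.card / p⌋₊ + 1)
  -- `(1 - p) ^ m ≤ exp (-p * m)` and `p * m > log (#T)`, so less than one set is left.
  have hT' : T' = ∅ := by
    rw [← Finset.card_eq_zero, ← Nat.lt_one_iff, ← Nat.cast_lt (α := ℝ)]
    calc (T'.card : ℝ) ≤ (1 - p) ^ (⌊Real.log T.card / p⌋₊ + 1) * T.card := hcard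
      _ ≤ Real.exp (-p) ^ (⌊Real.log T.card / p⌋₊ + 1) * T.card := by
        gcongr
        exact Real.one_sub_le_exp_neg p
      _ = Real.exp (-(p * (⌊Real.log T.card / p⌋₊ + 1))) * T.card := by
        rw [← Real.exp_nat_mul]; push_cast; ring_nf
      _ < Real.exp (-Real.log T.card) * T.card := by
        gcongr
        rw [← div_lt_iff₀' hp0]
        exact Nat.lt_floor_add_one _
      _ = ((1 : ℕ) : ℝ) := by
        rw [Real.exp_neg, Real.exp_log (by linarith), inv_mul_cancel₀ (by linarith), Nat.cast_one]
  refine ⟨P, ?_, fun i hi ↦ hit i hi (by simp [hT'])⟩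
  calc (P.card : ℝ) ≤ (⌊Real.log T.card / p⌋₊ : ℝ) + 1 := by exact_mod_cast hP
    _ ≤ _ := by gcongr; exact Nat.floor_le hlog

/-! ### Parallelepipeds and determinants -/

/-- The solid parallelepiped with centre `c` and edge vectors `(2 * s) • u i`, described as the points
`c + ∑ i, t i • u i` with `|t i| ≤ s`. The `u i` need not be linearly independent. -/
def centeredBox {ι E : Type*} [Fintype ι] [AddCommGroup E] [Module ℝ E]
    (c : E) (u : ι → E) (s : ℝ) : Set E :=
  {y | ∃ t : ι → ℝ, (∀ i, |t i| ≤ s) ∧ y = c + ∑ i, t i • u i}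

/-- The determinant of `d` vectors of `ℝ^d` with respect to the standard basis. -/
noncomputable def stdDet (d : ℕ) :
    EuclideanSpace ℝ (Fin d) [⋀^Fin d]→ₗ[ℝ] ℝ :=
  (EuclideanSpace.basisFun (Fin d) ℝ).toBasis.det

/-- Hadamard's inequality. -/
theorem abs_stdDet_le {d : ℕ} (v : Fin d → EuclideanSpace ℝ (Fin d)) :
    |stdDet d v| ≤ ∏ i, ‖v i‖ := by
  have : Fact (Module.finrank ℝ (EuclideanSpace ℝ (Fin d)) = d) := ⟨by simp⟩
  let b := EuclideanSpace.basisFun (Fin d) ℝ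
  have h := b.toBasis.orientation.volumeForm_robust b rfl
  have h2 := b.toBasis.orientation.abs_volumeForm_apply_le v
  rwa [h] at h2

/-- Cramer's rule. -/
theorem eq_sum_stdDet_update {d : ℕ} {u : Fin d → EuclideanSpace ℝ (Fin d)} (hu : stdDet d u ≠ 0)
    (y : EuclideanSpace ℝ (Fin d)) :
    y = ∑ i, (stdDet d (Function.update u i y) / stdDet d u) • u i := by
  obtain ⟨hli, hsp⟩ := (Module.Basis.is_basis_iff_det _).2 (isUnit_iff_ne_zero.2 hu)
  conv_lhs => rw [← (Module.Basis.mk hli hsp.ge).sum_repr y]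
  refine Finset.sum_congr rfl fun i _ ↦ ?_
  have h := congrArg (fun g ↦ g y)
    ((EuclideanSpace.basisFun (Fin d) ℝ).toBasis.det_smul_mk_coord_eq_det_update hli hsp.ge i)
  have h' : stdDet d u * (Module.Basis.mk hli hsp.ge).repr y i
      = stdDet d (Function.update u i y) := h
  rw [Module.Basis.mk_apply, ← h', mul_div_cancel_left₀ _ hu]

theorem centeredBox_eq_image_parallelepiped {ι E : Type*} [Fintype ι] [AddCommGroup E] [Module ℝ E]
    (c : E) (u : ι → E) {s : ℝ} (hs : 0 < s) :
    centeredBox c u s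
      = (fun y ↦ (c - s • ∑ i, u i) + y) '' parallelepiped (fun i ↦ (2 * s) • u i) := by
  ext y
  simp only [centeredBox, Set.mem_ofPred_eq, Set.mem_image, mem_parallelepiped_iff]
  constructor
  · rintro ⟨t, ht, rfl⟩
    refine ⟨_, ⟨fun i ↦ (t i + s) / (2 * s), ⟨fun i ↦ ?_, fun i ↦ ?_⟩, rfl⟩, ?_⟩
    · have := (abs_le.1 (ht i)).1
      exact div_nonneg (by linarith) (by linarith)
    · have := (abs_le.1 (ht i)).2
      exact (div_le_one (by linarith)).2 (by linarith)
    · have h : ∀ i, ((t i + s) / (2 * s)) • (2 * s) • u i = t i • u i + s • u i := fun i ↦ by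
        rw [smul_smul, div_mul_cancel₀ _ (by positivity), add_smul]
      simp only [h, Finset.sum_add_distrib, Finset.smul_sum]
      abel
  · rintro ⟨_, ⟨t, ht, rfl⟩, rfl⟩
    refine ⟨fun i ↦ (2 * t i - 1) * s, fun i ↦ ?_, ?_⟩
    · have h0 : 0 ≤ t i := ht.1 i
      have h1 : t i ≤ 1 := ht.2 i
      rw [abs_mul, abs_of_pos hs]
      have : |2 * t i - 1| ≤ 1 := abs_le.2 ⟨by linarith, by linarith⟩
      nlinarith
    · have h : ∀ i, ((2 * t i - 1) * s) • u i = t i • (2 * s) • u i - s • u i := fun i ↦ by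
        rw [smul_smul, ← sub_smul]; ring_nf
      simp only [h, Finset.sum_sub_distrib, Finset.smul_sum]
      abel

theorem centeredBox_mono {ι E : Type*} [Fintype ι] [AddCommGroup E] [Module ℝ E]
    (c : E) (u : ι → E) {s s' : ℝ} (h : s ≤ s') : centeredBox c u s ⊆ centeredBox c u s' := by
  rintro _ ⟨t, ht, rfl⟩
  exact ⟨t, fun i ↦ (ht i).trans h, rfl⟩

theorem volume_centeredBox {d : ℕ} (c : EuclideanSpace ℝ (Fin d))
    (u : Fin d → EuclideanSpace ℝ (Fin d)) {s : ℝ} (hs : 0 < s) :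
    volume (centeredBox c u s) = ENNReal.ofReal ((2 * s) ^ d * |stdDet d u|) := by
  have h := Measure.addHaar_parallelepiped
    (EuclideanSpace.basisFun (Fin d) ℝ).toBasis (fun i ↦ (2 * s) • u i)
  rw [OrthonormalBasis.addHaar_eq_volume] at h
  rw [centeredBox_eq_image_parallelepiped c u hs, Set.image_add_left, measure_preimage_add, h]
  congr 1
  change |stdDet d _| = _
  rw [(stdDet d).map_smul_univ (fun _ ↦ 2 * s) u]
  simp [abs_mul, abs_of_pos hs]

theorem measurableSet_centeredBox {d : ℕ} (c : EuclideanSpace ℝ (Fin d))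
    (u : Fin d → EuclideanSpace ℝ (Fin d)) {s : ℝ} (hs : 0 < s) :
    MeasurableSet (centeredBox c u s) := by
  rw [centeredBox_eq_image_parallelepiped c u hs]
  refine IsCompact.measurableSet (IsCompact.image ?_ (by fun_prop))
  exact isCompact_Icc.image (by fun_prop)

/-! ### Large parallelepipeds inside a convex set -/

/-- Vectors `v i - x₀` from `x₀` to points of `o` whose determinant is maximal up to a factor `2`. A
maximum itself need not exist, as `o` is not assumed closed. -/
theorem exists_le_two_mul_stdDet {d : ℕ} {o : Set (EuclideanSpace ℝ (Fin d))}
    (hb : o ⊆ Metric.closedBall 0 1) (ho : volume o ≠ 0) {x₀ : EuclideanSpace ℝ (Fin d)}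
    (hx₀ : x₀ ∈ o) :
    ∃ v : Fin d → EuclideanSpace ℝ (Fin d), (∀ i, v i ∈ o) ∧ stdDet d (fun i ↦ v i - x₀) ≠ 0 ∧
      ∀ v' : Fin d → EuclideanSpace ℝ (Fin d), (∀ i, v' i ∈ o) →
        |stdDet d (fun i ↦ v' i - x₀)| ≤ 2 * |stdDet d (fun i ↦ v i - x₀)| := by
  set S : Set ℝ := {a | ∃ v : Fin d → EuclideanSpace ℝ (Fin d), (∀ i, v i ∈ o) ∧
    |stdDet d (fun i ↦ v i - x₀)| = a} with hSdef
  have hnorm : ∀ x ∈ o, ‖x‖ ≤ 1 := fun x hx ↦ by simpa using hb hx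
  have hbdd : BddAbove S := by
    refine ⟨2 ^ d, ?_⟩
    rintro _ ⟨v, hv, rfl⟩
    calc _ ≤ ∏ i, ‖v i - x₀‖ := abs_stdDet_le _
      _ ≤ ∏ _i : Fin d, (2 : ℝ) := Finset.prod_le_prod (fun _ _ ↦ norm_nonneg _) fun i _ ↦
          (norm_sub_le _ _).trans (by linarith [hnorm _ (hv i), hnorm _ hx₀])
      _ = 2 ^ d := by simp
  -- Otherwise `o` would lie in a translate of a proper subspace, which is a null set.
  have hpos : ∃ v : Fin d → EuclideanSpace ℝ (Fin d), (∀ i, v i ∈ o) ∧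
      stdDet d (fun i ↦ v i - x₀) ≠ 0 := by
    have hspan : Submodule.span ℝ ((fun x ↦ x - x₀) '' o) = ⊤ := by
      by_contra hne
      apply ho
      have h := Measure.addHaar_submodule volume _ hne
      rw [← measure_preimage_add_right volume (-x₀)] at h
      refine measure_mono_null (fun x hx ↦ ?_) h
      exact Submodule.subset_span ⟨x, hx, sub_eq_add_neg x x₀⟩
    obtain ⟨s, hs, hsspan, hli⟩ := exists_linearIndependent ℝ ((fun x ↦ x - x₀) '' o)
    let b : Module.Basis s ℝ (EuclideanSpace ℝ (Fin d)) :=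
      Module.Basis.mk hli (by rw [Subtype.range_coe, hsspan, hspan])
    have hbs : ⇑b = Subtype.val := Module.Basis.coe_mk _ _
    have e : s ≃ Fin d := (b.indexEquiv (EuclideanSpace.basisFun (Fin d) ℝ).toBasis)
    have hmem : ∀ i, ∃ x ∈ o, x - x₀ = b.reindex e i := fun i ↦ by
      obtain ⟨x, hx, h⟩ := hs (e.symm i).2
      exact ⟨x, hx, by simpa [hbs] using h⟩
    choose v hv hvb using hmem
    refine ⟨v, hv, ?_⟩
    rw [funext hvb]
    exact (Module.Basis.isUnit_det _ _).ne_zero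
  obtain ⟨v₁, hv₁, hv₁0⟩ := hpos
  have hmem₁ : |stdDet d (fun i ↦ v₁ i - x₀)| ∈ S := ⟨v₁, hv₁, rfl⟩
  have hsup : 0 < sSup S := (abs_pos.2 hv₁0).trans_le (le_csSup hbdd hmem₁)
  obtain ⟨_, ⟨v, hv, rfl⟩, hlt⟩ := exists_lt_of_lt_csSup ⟨_, hmem₁⟩ (half_lt_self hsup)
  refine ⟨v, hv, fun h0 ↦ by rw [h0, abs_zero] at hlt; linarith, fun v' hv' ↦ ?_⟩
  have := le_csSup hbdd (show |stdDet d (fun i ↦ v' i - x₀)| ∈ S from ⟨v', hv', rfl⟩)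
  linarith

/-- A convex subset `o` of the unit ball of positive measure contains a parallelepiped of volume
`|stdDet d u| ≥ vol o / (4 * d) ^ d`; the bounds on `c` and `u` confine its parameters to a
bounded set. -/
theorem exists_centeredBox_subset {d : ℕ} (hd : 1 ≤ d) {o : Set (EuclideanSpace ℝ (Fin d))}
    (hconv : Convex ℝ o) (hb : o ⊆ Metric.closedBall 0 1) (ho : volume o ≠ 0) :
    ∃ (c : EuclideanSpace ℝ (Fin d)) (u : Fin d → EuclideanSpace ℝ (Fin d)),
      centeredBox c u (1 / 2) ⊆ o ∧ ‖c‖ ≤ 1 ∧ (∀ i, ‖u i‖ ≤ 2) ∧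
      volume o ≤ ENNReal.ofReal ((4 * d) ^ d * |stdDet d u|) := by
  have hd0 : (0 : ℝ) < d := by exact_mod_cast hd
  have hd1 : (1 : ℝ) ≤ d := by exact_mod_cast hd
  have hnorm : ∀ x ∈ o, ‖x‖ ≤ 1 := fun x hx ↦ by simpa using hb hx
  obtain ⟨x₀, hx₀⟩ := nonempty_of_measure_ne_zero ho
  obtain ⟨v, hv, hv0, hmax⟩ := exists_le_two_mul_stdDet hb ho hx₀
  set w : Fin d → EuclideanSpace ℝ (Fin d) := fun i ↦ v i - x₀ with hw
  -- Dividing the edges at `x₀` by `d` puts the parallelepiped they span inside the simplex.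
  set u : Fin d → EuclideanSpace ℝ (Fin d) := fun i ↦ (d : ℝ)⁻¹ • w i with hu
  set c := x₀ + (1 / 2 : ℝ) • ∑ i, u i with hc
  have hbox : centeredBox c u (1 / 2) ⊆ o := by
    rintro _ ⟨t, ht, rfl⟩
    have h0 : ∀ i, 0 ≤ (t i + 1 / 2) / d := fun i ↦
      div_nonneg (by linarith [(abs_le.1 (ht i)).1]) hd0.le
    have h1 : ∑ i, (t i + 1 / 2) / d ≤ 1 := by
      calc ∑ i, (t i + 1 / 2) / d ≤ ∑ _i : Fin d, (1 : ℝ) / d := by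
            gcongr with i; linarith [(abs_le.1 (ht i)).2]
        _ = 1 := by simp [hd0.ne']
    -- The point as a convex combination of `x₀` (index `none`) and the `v i`.
    have key : c + ∑ i, t i • u i = ∑ j : Option (Fin d),
        (j.elim (1 - ∑ i, (t i + 1 / 2) / d) (fun i ↦ (t i + 1 / 2) / d)) •
          (j.elim x₀ v) := by
      have h : ∀ i, ((t i + 1 / 2) / d) • v i
          = ((t i + 1 / 2) / d) • x₀ + (1 / 2 : ℝ) • u i + t i • u i := fun i ↦ by
        simp only [hu, hw]; module
      simp only [Fintype.sum_option, Option.elim, h, Finset.sum_add_distrib, ← Finset.sum_smul,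
        ← Finset.smul_sum, hc]
      module
    rw [key]
    refine hconv.sum_mem ?_ ?_ ?_
    · rintro (_ | i) -
      · simpa using h1
      · exact h0 i
    · simp [Fintype.sum_option]
    · rintro (_ | i) -
      · exact hx₀
      · exact hv i
  refine ⟨c, u, hbox, hnorm c (hbox ⟨0, by simp, by simp⟩), fun i ↦ ?_, ?_⟩
  · calc ‖u i‖ = (d : ℝ)⁻¹ * ‖w i‖ := by simp [hu, norm_smul]
      _ ≤ 1 * 2 := by
        gcongr
        · exact inv_le_one_of_one_le₀ hd1
        · exact (norm_sub_le _ _).trans (by linarith [hnorm _ (hv i), hnorm _ hx₀])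
      _ = 2 := one_mul 2
  · -- By Cramer's rule the coordinates in the basis `w` are ratios of determinants that the choice
    -- of `v` bounds by `2`.
    have hsub : o ⊆ centeredBox x₀ w 2 := fun y hy ↦ by
      refine ⟨fun i ↦ stdDet d (Function.update w i (y - x₀)) / stdDet d w, fun i ↦ ?_, ?_⟩
      · rw [abs_div, div_le_iff₀ (abs_pos.2 hv0)]
        have h := hmax (Function.update v i y) fun j ↦ by
          rcases eq_or_ne j i with rfl | h
          · simpa using hy
          · simpa [h] using hv j
        suffices hw' : Function.update w i (y - x₀) = fun j ↦ Function.update v i y j - x₀ by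
          rwa [hw']
        funext j
        rcases eq_or_ne j i with rfl | h
        · simp
        · simp [h, hw]
      · rw [← eq_sum_stdDet_update hv0]; abel
    have hdet : stdDet d u = (d : ℝ)⁻¹ ^ d * stdDet d w := by
      rw [hu, (stdDet d).map_smul_univ (fun _ ↦ (d : ℝ)⁻¹) w]; simp
    calc volume o ≤ volume (centeredBox x₀ w 2) := measure_mono hsub
      _ = _ := by
        rw [volume_centeredBox _ _ two_pos, hdet, abs_mul,
          abs_of_pos (by positivity : 0 < (d : ℝ)⁻¹ ^ d)]
        congr 1
        rw [← mul_assoc, ← mul_pow, mul_inv_cancel_right₀ hd0.ne']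
        norm_num

/-! ### A finite family of parallelepipeds -/

/-- A set of parameters with `Fintype.card κ` real coordinates in `[-R, R]` has a finite subset, of
the cardinality of a grid of mesh `η`, that approximates each of its points up to `η` in every
coordinate. -/
theorem exists_finset_net {Θ κ : Type*} [Fintype κ] (f : Θ → κ → ℝ) (A : Set Θ) {R η : ℝ}
    (hR : 0 ≤ R) (hη : 0 < η) (hA : ∀ a ∈ A, ∀ k, |f a k| ≤ R) :
    ∃ N : Finset Θ, (N.card : ℝ) ≤ (2 * (R / η) + 3) ^ Fintype.card κ ∧ (∀ a ∈ N, a ∈ A) ∧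
      ∀ a ∈ A, ∃ b ∈ N, ∀ k, |f a k - f b k| ≤ η := by
  classical
  set m : ℕ := ⌈R / η⌉₊ with hm
  let code : Θ → κ → ℤ := fun a k ↦ ⌊f a k / η⌋
  let codes : Finset (κ → ℤ) := Fintype.piFinset fun _ ↦ Finset.Icc (-(m : ℤ)) m
  have hcode : ∀ a ∈ A, code a ∈ codes := by
    intro a ha
    refine Fintype.mem_piFinset.2 fun k ↦ Finset.mem_Icc.2 ?_
    have h1 : |f a k / η| ≤ m := by
      rw [abs_div, abs_of_pos hη]
      exact (div_le_div_of_nonneg_right (hA a ha k) hη.le).trans (Nat.le_ceil _)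
    obtain ⟨h2, h3⟩ := abs_le.1 h1
    refine ⟨Int.le_floor.2 (by push_cast; exact h2), ?_⟩
    exact_mod_cast (Int.floor_le (f a k / η)).trans h3
  have hfin : (code '' A).Finite :=
    codes.finite_toSet.subset (by rintro _ ⟨a, ha, rfl⟩; exact hcode a ha)
  -- The net has one parameter from each nonempty cell of the grid.
  obtain ⟨N, hNA, hN⟩ := Set.exists_subset_bijOn A code
  have hNfin : N.Finite := Set.Finite.of_finite_image (hN.image_eq ▸ hfin) hN.injOn
  refine ⟨hNfin.toFinset, ?_, fun a ha ↦ hNA (hNfin.mem_toFinset.1 ha), fun a ha ↦ ?_⟩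
  · have h1 : hNfin.toFinset.card ≤ codes.card :=
      Finset.card_le_card_of_injOn code
        (fun a ha ↦ hcode a (hNA (hNfin.mem_toFinset.1 ha)))
        (fun a ha b hb h ↦ hN.injOn (hNfin.mem_toFinset.1 ha) (hNfin.mem_toFinset.1 hb) h)
    have h2 : codes.card = (2 * m + 1) ^ Fintype.card κ := by
      simp only [codes, Fintype.card_piFinset, Int.card_Icc, Finset.prod_const, Finset.card_univ]
      congr 1
      lia
    have h3 : (m : ℝ) < R / η + 1 := Nat.ceil_lt_add_one (by positivity)
    calc (hNfin.toFinset.card : ℝ) ≤ (2 * m + 1 : ℝ) ^ Fintype.card κ := by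
          exact_mod_cast h1.trans_eq h2
      _ ≤ _ := by gcongr ?_ ^ _; linarith
  · obtain ⟨b, hb, hab⟩ := hN.surjOn ⟨a, ha, rfl⟩
    refine ⟨b, hNfin.mem_toFinset.2 hb, fun k ↦ ?_⟩
    have h1 : |f a k / η - f b k / η| < 1 :=
      Int.abs_sub_lt_one_of_floor_eq_floor (congrFun hab k).symm
    rw [← sub_div, abs_div, abs_of_pos hη, div_lt_one hη] at h1
    exact h1.le

theorem EuclideanSpace.norm_le_card_mul_of_abs_le {d : ℕ} {x : EuclideanSpace ℝ (Fin d)} {η : ℝ}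
    (hx : ∀ k, |x k| ≤ η) : ‖x‖ ≤ d * η := by
  calc ‖x‖ = ‖∑ k, x k • EuclideanSpace.basisFun (Fin d) ℝ k‖ := by
        congr 1
        exact ((EuclideanSpace.basisFun (Fin d) ℝ).sum_repr x).symm
    _ ≤ ∑ k, ‖x k • EuclideanSpace.basisFun (Fin d) ℝ k‖ := norm_sum_le _ _
    _ ≤ ∑ _k : Fin d, η := by
        gcongr with k
        rw [norm_smul, OrthonormalBasis.norm_eq_one, mul_one]
        exact hx k
    _ = d * η := by simp

/-- Stability of inner parallelepipeds: a perturbation by `δ` of the centre and of the edges moves a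
point by `z` with `‖z‖ ≤ δ * (1 + d / 4)`. The coordinates of `z` in the basis `u` are at most
`2 ^ d * ‖z‖ / |stdDet d u| ≤ 1 / 4` by Cramer's rule and Hadamard's inequality. -/
theorem centeredBox_subset_centeredBox {d : ℕ} {c c' : EuclideanSpace ℝ (Fin d)}
    {u u' : Fin d → EuclideanSpace ℝ (Fin d)} {τ δ : ℝ} (hτ : 0 < τ) (hu : ∀ i, ‖u i‖ ≤ 2)
    (hdet : τ ≤ |stdDet d u|) (hc : ‖c' - c‖ ≤ δ) (huu' : ∀ i, ‖u' i - u i‖ ≤ δ)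
    (hδ : δ * ((4 + d) * 2 ^ d) ≤ τ) :
    centeredBox c' u' (1 / 4) ⊆ centeredBox c u (1 / 2) := by
  rintro _ ⟨t, ht, rfl⟩
  have hδ0 : 0 ≤ δ := (norm_nonneg _).trans hc
  have hdet0 : stdDet d u ≠ 0 := abs_pos.1 (hτ.trans_le hdet)
  set z := (c' - c) + ∑ i, t i • (u' i - u i) with hz
  have hznorm : ‖z‖ ≤ δ * (1 + d / 4) := by
    calc ‖z‖ ≤ ‖c' - c‖ + ∑ i, ‖t i • (u' i - u i)‖ :=
          (norm_add_le _ _).trans (by gcongr; exact norm_sum_le _ _)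
      _ ≤ δ + ∑ _i : Fin d, 1 / 4 * δ := by
          gcongr with i
          rw [norm_smul, Real.norm_eq_abs]
          gcongr
          · exact ht i
          · exact huu' i
      _ = _ := by simp; ring
  refine ⟨fun i ↦ t i + stdDet d (Function.update u i z) / stdDet d u, fun i ↦ ?_, ?_⟩
  · have h1 : |stdDet d (Function.update u i z)| ≤ 2 ^ d * ‖z‖ := by
      calc _ ≤ ∏ j, ‖Function.update u i z j‖ := abs_stdDet_le _
        _ = ‖z‖ * ∏ j ∈ Finset.univ.erase i, ‖Function.update u i z j‖ := by
          rw [← Finset.mul_prod_erase _ _ (Finset.mem_univ i), Function.update_self]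
        _ ≤ ‖z‖ * ∏ _j ∈ Finset.univ.erase i, (2 : ℝ) := by
          gcongr with j hj
          rw [Function.update_of_ne (Finset.ne_of_mem_erase hj)]
          exact hu j
        _ ≤ ‖z‖ * 2 ^ d := by
          rw [Finset.prod_const]
          gcongr
          · norm_num
          · exact (Finset.card_le_univ _).trans_eq (Fintype.card_fin d)
        _ = _ := mul_comm _ _
    have h2 : |stdDet d (Function.update u i z) / stdDet d u| ≤ 1 / 4 := by
      rw [abs_div, div_le_iff₀ (abs_pos.2 hdet0)]
      calc _ ≤ 2 ^ d * (δ * (1 + d / 4)) := h1.trans (by gcongr)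
        _ = 1 / 4 * (δ * ((4 + d) * 2 ^ d)) := by ring
        _ ≤ _ := by gcongr; exact hδ.trans hdet
    calc _ ≤ |t i| + |stdDet d (Function.update u i z) / stdDet d u| := abs_add_le _ _
      _ ≤ 1 / 2 := by linarith [ht i]
  · simp only [add_smul, Finset.sum_add_distrib]
    rw [← eq_sum_stdDet_update hdet0 z, hz]
    simp only [smul_sub, Finset.sum_sub_distrib]
    abel

/-- Finitely many parallelepipeds, polynomially many in `1 / τ`, such that every convex subset
of the unit ball of volume at least `(4 * d) ^ d * τ` contains one of them. By the lower bound on the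
determinant, each of them has volume at least `τ / 2 ^ d`. -/
theorem exists_finset_small_boxes {d : ℕ} (hd : 1 ≤ d) {τ : ℝ} (hτ : 0 < τ) :
    ∃ N : Finset (EuclideanSpace ℝ (Fin d) × (Fin d → EuclideanSpace ℝ (Fin d))),
      (N.card : ℝ) ≤ (4 * (d * ((4 + d) * 2 ^ d)) / τ + 3) ^ (d + d * d) ∧
      (∀ q ∈ N, τ ≤ |stdDet d q.2| ∧ centeredBox q.1 q.2 (1 / 4) ⊆ Metric.closedBall 0 1) ∧
      ∀ o : Set (EuclideanSpace ℝ (Fin d)), Convex ℝ o → o ⊆ Metric.closedBall 0 1 →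
        ENNReal.ofReal ((4 * d) ^ d * τ) ≤ volume o →
          ∃ q ∈ N, centeredBox q.1 q.2 (1 / 4) ⊆ o := by
  have hd0 : (0 : ℝ) < d := by exact_mod_cast hd
  -- Coordinates that agree up to `η` give vectors at distance at most `d * η`, and `d * η` is the
  -- perturbation that `centeredBox_subset_centeredBox` allows.
  set η : ℝ := τ / (d * ((4 + d) * 2 ^ d)) with hη
  have hη0 : 0 < η := by positivity
  obtain ⟨N, hNcard, hNA, hN⟩ := exists_finset_net
    (fun q : EuclideanSpace ℝ (Fin d) × (Fin d → EuclideanSpace ℝ (Fin d)) ↦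
      Sum.elim (fun k ↦ q.1 k) (fun jk : Fin d × Fin d ↦ q.2 jk.1 jk.2))
    -- The net consists of admissible parameters, so its members inherit the lower bound on the
    -- determinant from the set that it discretizes.
    {q | ‖q.1‖ ≤ 1 ∧ (∀ i, ‖q.2 i‖ ≤ 2) ∧ τ ≤ |stdDet d q.2| ∧
      centeredBox q.1 q.2 (1 / 2) ⊆ Metric.closedBall 0 1} zero_le_two hη0 (by
      rintro q ⟨h1, h2, -⟩ (k | ⟨j, k⟩)
      · exact (PiLp.norm_apply_le q.1 k).trans (h1.trans one_le_two)
      · exact (PiLp.norm_apply_le (q.2 j) k).trans (h2 j))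
  refine ⟨N, hNcard.trans_eq ?_, fun q hq ↦ ?_, fun o hconv hb hvol ↦ ?_⟩
  · simp only [Fintype.card_sum, Fintype.card_prod, Fintype.card_fin]
    congr 2
    rw [hη]
    field_simp
    norm_num
  · obtain ⟨-, -, h1, h2⟩ := hNA q hq
    exact ⟨h1, (centeredBox_mono _ _ (by norm_num)).trans h2⟩
  · have hpos : 0 < (4 * d : ℝ) ^ d := by positivity
    have ho : volume o ≠ 0 :=
      ((ENNReal.ofReal_pos.2 (by positivity)).trans_le hvol).ne'
    obtain ⟨c, u, hbox, hc, hu, hle⟩ := exists_centeredBox_subset hd hconv hb ho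
    have hdet : τ ≤ |stdDet d u| := by
      have h := (ENNReal.ofReal_le_ofReal_iff (by positivity)).1 (hvol.trans hle)
      exact le_of_mul_le_mul_left h hpos
    obtain ⟨q, hq, hqa⟩ := hN (c, u) ⟨hc, hu, hdet, hbox.trans hb⟩
    refine ⟨q, hq, (centeredBox_subset_centeredBox (δ := d * η) hτ hu hdet ?_ (fun i ↦ ?_)
      (le_of_eq ?_)).trans hbox⟩
    · rw [norm_sub_rev]
      exact EuclideanSpace.norm_le_card_mul_of_abs_le fun k ↦ hqa (Sum.inl k)
    · rw [norm_sub_rev]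
      exact EuclideanSpace.norm_le_card_mul_of_abs_le fun k ↦ hqa (Sum.inr (i, k))
    · rw [hη]; field_simp

/-! ### A stabbing set for all large convex subsets of a ball -/

/-- A universal stabbing set for the large convex subsets of the unit ball; its size depends on `d`
and `α` only. -/
theorem exists_stabbing_finset_closedBall_one {d : ℕ} (hd : 1 ≤ d) :
    ∃ C : ℝ, 1 ≤ C ∧ ∀ α : ℝ, 1 ≤ α → ∃ P : Finset (EuclideanSpace ℝ (Fin d)),
      (P.card : ℝ) ≤ C * (α ^ d * (1 + Real.log α)) ∧
      ∀ o : Set (EuclideanSpace ℝ (Fin d)), Convex ℝ o → o ⊆ Metric.closedBall 0 1 →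
        ENNReal.ofReal ((1 / α) ^ d) *
          volume (Metric.closedBall (0 : EuclideanSpace ℝ (Fin d)) 1) ≤ volume o →
        ∃ p ∈ P, p ∈ o := by
  have hd0 : (0 : ℝ) < d := by exact_mod_cast hd
  set ball := Metric.closedBall (0 : EuclideanSpace ℝ (Fin d)) 1 with hball
  have hball0 : volume ball ≠ 0 := (Metric.measure_closedBall_pos _ _ one_pos).ne'
  have hballtop : volume ball ≠ ⊤ := measure_closedBall_lt_top.ne
  set V : ℝ := volume.real ball with hV
  have hV0 : 0 < V := ENNReal.toReal_pos hball0 hballtop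
  have hVball : volume ball = ENNReal.ofReal V := (ENNReal.ofReal_toReal hballtop).symm
  -- The family of parallelepipeds below has at most `(B * α ^ d) ^ (d + d * d)` members.
  set B : ℝ := 4 * (d * ((4 + d) * 2 ^ d)) * (4 * d) ^ d / V + 3 with hB
  have hB3 : 3 ≤ B := le_add_of_nonneg_left (by positivity)
  have hlogB : 0 ≤ Real.log B := Real.log_nonneg (by linarith)
  refine ⟨(8 * d) ^ d * ((d + d * d) * (Real.log B + d)) + 1,
    le_add_of_nonneg_left (by positivity), fun α hα ↦ ?_⟩
  have hα0 : 0 < α := by linarith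
  have hlog : 0 ≤ Real.log α := Real.log_nonneg hα
  have hαd : 1 ≤ α ^ d := one_le_pow₀ hα
  -- `(4 * d) ^ d * τ` is the least volume `V / α ^ d` of the sets to be stabbed.
  set τ : ℝ := V / (4 * d * α) ^ d with hτ
  have hτ0 : 0 < τ := by positivity
  obtain ⟨N, hNcard, hNdet, hN⟩ := exists_finset_small_boxes hd hτ0
  -- `p` is the least proportion `(τ / 2 ^ d) / V` of the ball that a parallelepiped occupies.
  set p : ℝ := 1 / (8 * d * α) ^ d with hp
  have hp0 : 0 < p := by positivity
  have := ProbabilityTheory.cond_isProbabilityMeasure_of_finite hball0 hballtop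
  obtain ⟨P, hPcard, hP⟩ := exists_hitting_set (ProbabilityTheory.cond volume ball)
    (fun q : N ↦ centeredBox q.1.1 q.1.2 (1 / 4))
    (fun q ↦ measurableSet_centeredBox _ _ (by norm_num)) hp0 (fun q ↦ by
      obtain ⟨h1, h2⟩ := hNdet q.1 q.2
      rw [measureReal_def, ProbabilityTheory.cond_apply Metric.isClosed_closedBall.measurableSet,
        Set.inter_eq_self_of_subset_right h2, ENNReal.toReal_mul, ENNReal.toReal_inv,
        ← measureReal_def, ← hV, le_inv_mul_iff₀ hV0,
        volume_centeredBox _ _ (by norm_num), ENNReal.toReal_ofReal (by positivity)]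
      calc V * p = (2 * (1 / 4)) ^ d * τ := by
            rw [hp, hτ, show 8 * d * α = 2 * (4 * d * α) by ring, mul_pow 2,
              show (2 : ℝ) * (1 / 4) = 2⁻¹ by norm_num, inv_pow]
            field_simp
        _ ≤ _ := by gcongr) Finset.univ
  refine ⟨P, hPcard.trans ?_, fun o hconv hb hvol ↦ ?_⟩
  · rw [Finset.card_univ, Fintype.card_coe]
    have hK : (N.card : ℝ) ≤ (B * α ^ d) ^ (d + d * d) := by
      refine hNcard.trans (pow_le_pow_left₀ (by positivity) ?_ _)
      calc _ = 4 * (d * ((4 + d) * 2 ^ d)) * (4 * d) ^ d / V * α ^ d + 3 := by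
            rw [hτ, mul_pow _ α]; field_simp
        _ ≤ 4 * (d * ((4 + d) * 2 ^ d)) * (4 * d) ^ d / V * α ^ d + 3 * α ^ d := by
            gcongr; linarith
        _ = B * α ^ d := by rw [hB]; ring
    have hlogK : Real.log N.card ≤ (d + d * d) * (Real.log B + d) * (1 + Real.log α) := by
      rcases Nat.eq_zero_or_pos N.card with h0 | h0
      · rw [h0, Nat.cast_zero, Real.log_zero]; positivity
      calc Real.log N.card ≤ Real.log ((B * α ^ d) ^ (d + d * d)) :=
            Real.log_le_log (by exact_mod_cast h0) hK
        _ = (d + d * d) * (Real.log B + d * Real.log α) := by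
            rw [Real.log_pow, Real.log_mul (by positivity) (by positivity), Real.log_pow]
            push_cast; rfl
        _ ≤ (d + d * d) * ((Real.log B + d) * (1 + Real.log α)) := by
            gcongr
            nlinarith [mul_nonneg hlogB hlog]
        _ = _ := by ring
    calc Real.log N.card / p + 1
        ≤ (d + d * d) * (Real.log B + d) * (1 + Real.log α) / p
          + 1 * (α ^ d * (1 + Real.log α)) := by
          gcongr
          nlinarith
      _ = _ := by rw [hp, mul_pow _ α]; field_simp
  · have hvol' : ENNReal.ofReal ((4 * d) ^ d * τ) ≤ volume o := by
      refine le_trans (le_of_eq ?_) hvol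
      rw [hVball, ← ENNReal.ofReal_mul (by positivity), hτ, mul_pow _ α, one_div, inv_pow]
      congr 1
      field_simp
    obtain ⟨q, hq, hqo⟩ := hN o hconv hb hvol'
    obtain ⟨x, hx, hxq⟩ := hP ⟨q, hq⟩ (Finset.mem_univ _)
    exact ⟨x, hx, hqo hxq⟩

/-- The stabbing set of the unit ball, transported by `y ↦ x + r • y`. -/
theorem exists_stabbing_finset_closedBall {d : ℕ} (hd : 1 ≤ d) :
    ∃ C : ℝ, 1 ≤ C ∧ ∀ α : ℝ, 1 ≤ α → ∀ (x : EuclideanSpace ℝ (Fin d)) (r : ℝ), 0 < r →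
      ∃ P : Finset (EuclideanSpace ℝ (Fin d)),
        (P.card : ℝ) ≤ C * (α ^ d * (1 + Real.log α)) ∧
        ∀ o : Set (EuclideanSpace ℝ (Fin d)), Convex ℝ o → o ⊆ Metric.closedBall x r →
          ENNReal.ofReal ((1 / α) ^ d) * volume (Metric.closedBall x r) ≤ volume o →
          ∃ p ∈ P, p ∈ o := by
  classical
  obtain ⟨C, hC, h⟩ := exists_stabbing_finset_closedBall_one hd
  refine ⟨C, hC, fun α hα x r hr ↦ ?_⟩
  obtain ⟨P, hPcard, hP⟩ := h α hα
  refine ⟨P.image (fun y ↦ x + r • y),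
    le_trans (by exact_mod_cast Finset.card_image_le) hPcard, fun o hconv hb hvol ↦ ?_⟩
  have hpre : volume ((fun y ↦ x + r • y) ⁻¹' o) = ENNReal.ofReal (r ^ d)⁻¹ * volume o := by
    have : (fun y ↦ x + r • y) ⁻¹' o = (r • ·) ⁻¹' ((x + ·) ⁻¹' o) := rfl
    rw [this, Measure.addHaar_preimage_smul _ hr.ne', measure_preimage_add]
    simp [abs_of_pos hr]
  have hconv' : Convex ℝ ((fun y ↦ x + r • y) ⁻¹' o) :=
    (hconv.translate_preimage_right x).is_linear_preimage (IsLinearMap.isLinearMap_smul r)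
  have hb' : (fun y ↦ x + r • y) ⁻¹' o ⊆ Metric.closedBall 0 1 := by
    intro y hy
    have := hb hy
    rw [mem_closedBall_iff_norm, add_sub_cancel_left, norm_smul, Real.norm_eq_abs,
      abs_of_pos hr] at this
    rw [mem_closedBall_zero_iff]
    exact le_of_mul_le_mul_left (by linarith) hr
  have hvol' : ENNReal.ofReal ((1 / α) ^ d) *
      volume (Metric.closedBall (0 : EuclideanSpace ℝ (Fin d)) 1)
        ≤ volume ((fun y ↦ x + r • y) ⁻¹' o) := by
    rw [hpre]
    rw [Measure.addHaar_closedBall' _ x hr.le, finrank_euclideanSpace_fin] at hvol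
    calc _ = ENNReal.ofReal (r ^ d)⁻¹ * (ENNReal.ofReal ((1 / α) ^ d) *
          (ENNReal.ofReal (r ^ d) *
            volume (Metric.closedBall (0 : EuclideanSpace ℝ (Fin d)) 1))) := by
          rw [mul_left_comm, ← mul_assoc (ENNReal.ofReal (r ^ d)⁻¹),
            ← ENNReal.ofReal_mul (by positivity), inv_mul_cancel₀ (by positivity),
            ENNReal.ofReal_one, one_mul]
      _ ≤ _ := by gcongr
  obtain ⟨p, hp, hpo⟩ := hP _ hconv' hb' hvol'
  exact ⟨_, Finset.mem_image_of_mem _ hp, hpo⟩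

/-! ### The stabbing number of weakly fat convex objects -/

theorem volume_le_of_isWeaklyFat {d : ℕ} {α r : ℝ} (hα : 0 < α) (hr : 0 < r)
    {o : Set (EuclideanSpace ℝ (Fin d))} (ho : IsWeaklyFat (1 / α) o)
    (hdiam : r / 2 ≤ Metric.diam o) (x : EuclideanSpace ℝ (Fin d)) :
    ENNReal.ofReal ((1 / (4 * α)) ^ d) * volume (Metric.closedBall x r) ≤ volume o := by
  obtain ⟨-, c, R, ⟨hR, hsub, -⟩, hvol⟩ := ho
  have hrR : r / 4 ≤ R := by
    have := (Metric.diam_mono hsub Metric.isBounded_closedBall).trans (Metric.diam_closedBall hR)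
    linarith
  refine le_trans ?_ hvol
  rw [Measure.addHaar_closedBall' _ x hr.le, Measure.addHaar_closedBall' _ c hR,
    finrank_euclideanSpace_fin, ← mul_assoc, ← mul_assoc, ← ENNReal.ofReal_mul (by positivity),
    ← ENNReal.ofReal_mul (by positivity)]
  gcongr ENNReal.ofReal ?_ * _
  calc (1 / (4 * α)) ^ d * r ^ d = (1 / α) ^ d * (r / 4) ^ d := by
        rw [← mul_pow, ← mul_pow]; congr 1; field_simp
    _ ≤ _ := by gcongr

/-- The stabbing set for volume parameter `4 * α` serves every ball of positive radius; for `r ≤ 0`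
the family to be stabbed is empty. -/
theorem exists_isStabbed_of_isWeaklyFat {d : ℕ} (hd : 1 ≤ d) :
    ∃ C : ℝ, 1 ≤ C ∧ ∀ α : ℝ, 1 ≤ α → ∀ F : Set (Set (EuclideanSpace ℝ (Fin d))),
      (∀ o ∈ F, Convex ℝ o ∧ IsWeaklyFat (1 / α) o) →
      ∀ a : ℝ, C * (α ^ d * (1 + Real.log α)) ≤ a ^ d → IsStabbed a F := by
  obtain ⟨C, hC, h⟩ := exists_stabbing_finset_closedBall hd
  have hlog4 : 0 ≤ Real.log 4 := Real.log_nonneg (by norm_num)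
  refine ⟨C * (4 ^ d * (1 + Real.log 4)), ?_, fun α hα F hF a ha r x ↦ ?_⟩
  · exact one_le_mul_of_one_le_of_one_le hC
      (one_le_mul_of_one_le_of_one_le (one_le_pow₀ (by norm_num)) (by linarith))
  have hlog : 0 ≤ Real.log α := Real.log_nonneg hα
  have hcard : C * ((4 * α) ^ d * (1 + Real.log (4 * α))) ≤ a ^ d := by
    refine le_trans ?_ ha
    rw [Real.log_mul (by norm_num) (by linarith), mul_pow]
    calc C * (4 ^ d * α ^ d * (1 + (Real.log 4 + Real.log α)))
        ≤ C * (4 ^ d * α ^ d * ((1 + Real.log 4) * (1 + Real.log α))) := by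
          gcongr
          nlinarith [mul_nonneg hlog4 hlog]
      _ = _ := by ring
  rcases le_or_gt r 0 with hr | hr
  · refine ⟨∅, ?_, fun o ⟨_, _, h1, h2⟩ ↦ ?_⟩
    · refine le_trans ?_ ha
      simp only [Finset.card_empty, Nat.cast_zero]
      positivity
    · linarith [Metric.diam_nonneg (s := o)]
  · obtain ⟨P, hPcard, hP⟩ := h (4 * α) (by linarith) x r hr
    refine ⟨P, hPcard.trans hcard, fun o ⟨hoF, hob, hdiam, _⟩ ↦ ?_⟩
    obtain ⟨hconv, hfat⟩ := hF o hoF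
    exact hP o hconv hob (volume_le_of_isWeaklyFat (by linarith) hr hfat hdiam x)

theorem stabbingNumber_le {d : ℕ} {a : ℝ} {F : Set (Set (EuclideanSpace ℝ (Fin d)))} (ha : 1 ≤ a)
    (hF : IsStabbed a F) : stabbingNumber F ≤ ENNReal.ofReal a :=
  iInf_le_of_le a <| iInf_le_of_le ha <| iInf_le_of_le hF le_rfl

theorem mainTheorem9 (d : ℕ) (hd : 1 ≤ d) :
    ∃ C : ℝ, 0 < C ∧
      ∀ (n : ℕ) (α : ℝ), 1 ≤ α →
        ∀ F : Finset (Set (EuclideanSpace ℝ (Fin d))), F.card = n →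
          (∀ o ∈ F, Convex ℝ o ∧ IsWeaklyFat (1 / α) o) →
            stabbingNumber (F : Set (Set (EuclideanSpace ℝ (Fin d)))) ≤
                ENNReal.ofReal (C * (α * (1 + Real.log α) ^ (1 / (d : ℝ)))) ∧
            (2 ≤ α →
              stabbingNumber (F : Set (Set (EuclideanSpace ℝ (Fin d)))) ≤
                ENNReal.ofReal (C * (α * Real.log α ^ (1 / (d : ℝ))))) := by
 

  obtain ⟨C, hC, h⟩ := exists_isStabbed_of_isWeaklyFat hd
  have hd0 : d ≠ 0 := by lia
  refine ⟨(3 * C) ^ (1 / (d : ℝ)), by positivity, fun n α hα F _ hF ↦ ?_⟩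
  have hα0 : 0 < α := by linarith
  have hαd : 1 ≤ α ^ d := one_le_pow₀ hα
  have hlog : 0 ≤ Real.log α := Real.log_nonneg hα
  -- Both bounds are instances with `L = 1 + log α` and `L = log α`; the factor `3` absorbs the
  -- summand `1` in the second one, as `log α ≥ log 2 > 1 / 2`.
  have bound : ∀ L : ℝ, 1 + Real.log α ≤ 3 * L →
      stabbingNumber (F : Set (Set (EuclideanSpace ℝ (Fin d))))
        ≤ ENNReal.ofReal ((3 * C) ^ (1 / (d : ℝ)) * (α * L ^ (1 / (d : ℝ)))) := by
    intro L hL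
    have hL0 : 0 ≤ L := by linarith
    have hpow : ((3 * C) ^ (1 / (d : ℝ)) * (α * L ^ (1 / (d : ℝ)))) ^ d
        = C * (α ^ d * (3 * L)) := by
      rw [mul_pow, mul_pow, one_div, Real.rpow_inv_natCast_pow (by positivity) hd0,
        Real.rpow_inv_natCast_pow hL0 hd0]
      ring
    have hle : C * (α ^ d * (1 + Real.log α))
        ≤ ((3 * C) ^ (1 / (d : ℝ)) * (α * L ^ (1 / (d : ℝ)))) ^ d := by
      rw [hpow]; gcongr
    refine stabbingNumber_le ?_ (h α hα F hF _ hle)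
    rw [← one_le_pow_iff_of_nonneg (by positivity) hd0]
    exact (one_le_mul_of_one_le_of_one_le hC
      (one_le_mul_of_one_le_of_one_le hαd (by linarith))).trans hle
  refine ⟨bound _ (by linarith), fun hα2 ↦ bound _ ?_⟩
  have : Real.log 2 ≤ Real.log α := Real.log_le_log two_pos hα2
  linarith [Real.log_two_gt_d9]
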